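/- Let $(I,\le)$ be a totally ordered set and let $(\mathcal A_i,\varphi_i)_{i\in I}$ be a family of $C^*$-probability spaces (unital $C^*$-algebras with states). For each $i$ let $\mathcal H_i$ be a Hilbert space, $\xi_i\in\mathcal H_i$ a unit vector and $\sigma_i:\mathcal A_i\to B(\mathcal H_i)$ a unital $*$-representation with $\varphi_i(a)=\langle\sigma_i(a)\xi_i,\xi_i\rangle$ for all $a\in\mathcal A_i$ (for instance the GNS triple of $\varphi_i$). Put $\mathring{\mathcal H}_i=\mathcal H_i\ominus\mathbb C\xi_i$. **Spaces.** For $n\ge1$ let $I_n$ be the set of all $(i_1,\dots,i_n)\in I^n$ with $i_1>\dots>i_m<\dots<i_n$ for some $1\le m\le n$. Let $$\mathcal F=\mathbb C\xi\oplus\bigoplus_{n\ge1}\ \bigoplus_{i_1\ne i_2\ne\dots\ne i_n}\mathring{\mathcal H}_{i_1}\otimes\dots\otimes\mathring{\mathcal H}_{i_n},\qquad \|\xi\|=1,$$ be the free product of the $(\mathcal H_i,\xi_i)$, let $\mathcal F(i)\subseteq\mathcal F$ be the sum of $\mathbb C\xi$ and of the summands with $i_1\ne i$, and let $V_i:\mathcal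 H_i\otimes\mathcal F(i)\to\mathcal F$ be the unitary with $V_i(\xi_i\otimes f)=f$, $V_i(x\otimes\xi)=x$ and $V_i(x\otimes(x_1\otimes\dots\otimes x_n))=x\otimes x_1\otimes\dots\otimes x_n$ for $f\in\mathcal F(i)$, $x\in\mathring{\mathcal H}_i$, $x_k\in\mathring{\mathcal H}_{i_k}$, $i\neq i_1\ne\dots\ne i_n$. Put $\lambda_i(T)=V_i(T\otimes\mathrm{id})V_i^{-1}$ for $T\in B(\mathcal H_i)$. The V-monotone product of Hilbert spaces is the closed subspace $$\mathcal V=\mathbb C\xi\oplus\bigoplus_{n\ge1}\ \bigoplus_{(i_1,\dots,i_n)\in I_n}\mathring{\mathcal H}_{i_1}\otimes\dots\otimes\mathring{\mathcal H}_{i_n}\subseteq\mathcal F .$$ Let $U_i$ be the orthogonal projection of $\mathcal F$ onto the sum of $\mathbb C\xi$ and of the summands of $\mathcal V$ with $i_1=i$ or $(i,i_1,\dots,i_n)\in I_{n+1}$. Put $\widetilde\lambda_i(T)=U_i\lambda_i(T)U_i$ (it maps $\mathcal F$ into $\mathcal V$ and is a non-unital $*$-representation) and $\varphi(T)=\langle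 T\xi,\xi\rangle$ for operators $T$ on $\mathcal F$ or on $\mathcal V$. **Independence.** A family $(\mathcal B_i)_{i\in I}$ of subalgebras of a unital algebra $\mathcal B$, with inner units $\mathbf 1_i\in\mathcal B_i$, is V-monotonically independent with respect to a linear functional $\psi$ with $\psi(\mathbf 1)=1$ if $\psi(\mathbf 1_i)=1$ for all $i$ and, for all $n\ge 1$, all $(i_1,\dots,i_n)\in I^n$ with $i_k\neq i_{k+1}$ for $1\le k<n$ and all $a_k\in\mathcal B_{i_k}$: (i) $\psi(a_1\cdots a_n)=0$ if $\psi(a_1)=\dots=\psi(a_n)=0$; (ii) if $1\le j\le n$, $\psi(a_1)=\dots=\psi(a_{j-1})=0$, and $r\in\{1,\dots,n\}$ is such that $(i_1,\dots,i_r)\in I_r$ and either $r=n$ or $(i_1,\dots,i_{r+1})\notin I_{r+1}$, then $\psi(a_1\cdots a_{j-1}\mathbf 1_{i_j}a_{j+1}\cdots a_n)$ equals $\psi(a_1\cdots a_{j-1}a_{j+1}\cdots a_n)$ if $j\le r$ and $0$ if $j>r$. **Theorem.** The family of algebras $\big((\widetilde\lambda_i\circ\sigma_i)(\mathcal A_i)\big)_{i\in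 I}$ is V-monotonically independent with respect to the vacuum state $\varphi$, both as algebras of operators on $\mathcal F$ and, by restriction, as algebras of operators on $\mathcal V$; moreover $\varphi(\widetilde\lambda_i(\sigma_i(a)))=\varphi_i(a)$ for $a\in\mathcal A_i$. Consequently, let $\mathcal A$ be the free product of the $C^*$-algebras $\mathcal A_i$ without identification of units, with a unit adjoined, and let $\iota_i:\mathcal A_i\to\mathcal A$ be the canonical embeddings. The V-monotone product of states $\phi$ on $\mathcal A$, i.e. the continuous linear functional with $\phi(1)=1$ and $$\phi(\iota_{i_1}(a_1)\cdots\iota_{i_n}(a_n))=\varphi\big(\widetilde\lambda_{i_1}(\sigma_{i_1}(a_1))\cdots\widetilde\lambda_{i_n}(\sigma_{i_n}(a_n))\big)$$ for all $i_1,\dots,i_n\in I$ and $a_k\in\mathcal A_{i_k}$, is a state, $\phi\circ\iota_i=\varphi_i$ for every $i$, and the family $(\iota_i(\mathcal A_i))_{i\in I}$ is V-monotonically independent with respect to $\phi$. -/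

import Mathlib

open scoped TensorProduct InnerProductSpace ENNReal ComplexOrder

universe u v w

noncomputable section

set_option linter.unusedSectionVars false

namespace VMonotone

/-! ### Hilbert space tensor products -/

section HilbertTensor

variable {E E' E'' F : Type*}
  [NormedAddCommGroup E] [InnerProductSpace ℂ E]
  [NormedAddCommGroup E'] [InnerProductSpace ℂ E']
  [NormedAddCommGroup E''] [InnerProductSpace ℂ E'']
  [NormedAddCommGroup F] [InnerProductSpace ℂ F]

variable (E F) in
/-- The Hilbert space tensor product: the completion of the algebraic tensor product for the
scalar product `⟪a ⊗ b, c ⊗ d⟫ = ⟪a, c⟫ * ⟪b, d⟫`. -/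
abbrev HTensor : Type _ := UniformSpace.Completion (E ⊗[ℂ] F)

/-- The elementary tensor `x ⊗ y` in the Hilbert space tensor product. -/
def htmul (x : E) (y : F) : HTensor E F := ((x ⊗ₜ[ℂ] y : E ⊗[ℂ] F) : HTensor E F)

theorem inner_htmul (x x' : E) (y y' : F) :
    ⟪htmul x y, htmul x' y'⟫_ℂ = ⟪x, x'⟫_ℂ * ⟪y, y'⟫_ℂ := by
  simp [htmul, UniformSpace.Completion.inner_coe]

theorem htmul_add_left (x x' : E) (y : F) : htmul (x + x') y = htmul x y + htmul x' y := by
  simp [htmul, TensorProduct.add_tmul, UniformSpace.Completion.coe_add]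

theorem htmul_add_right (x : E) (y y' : F) : htmul x (y + y') = htmul x y + htmul x y' := by
  simp [htmul, TensorProduct.tmul_add, UniformSpace.Completion.coe_add]

theorem htmul_smul_left (c : ℂ) (x : E) (y : F) : htmul (c • x) y = c • htmul x y := by
  rw [htmul, ← TensorProduct.smul_tmul', UniformSpace.Completion.coe_smul, htmul]

theorem htmul_smul_right (c : ℂ) (x : E) (y : F) : htmul x (c • y) = c • htmul x y := by
  rw [htmul, TensorProduct.tmul_smul, UniformSpace.Completion.coe_smul, htmul]

theorem norm_htmul (x : E) (y : F) : ‖htmul x y‖ = ‖x‖ * ‖y‖ := by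
  simp [htmul]

/-- The vectors on which two bounded operators agree form a closed subspace, so it is enough to
compare them on elementary tensors. -/
theorem htensor_ext {G : Type*} [NormedAddCommGroup G] [NormedSpace ℂ G]
    {f g : HTensor E F →L[ℂ] G} (h : ∀ x y, f (htmul x y) = g (htmul x y)) : f = g := by
  ext z
  induction z using UniformSpace.Completion.induction_on with
  | hp => exact isClosed_eq f.continuous g.continuous
  | ih z =>
    induction z using TensorProduct.induction_on with
    | zero => exact (map_zero f).trans (map_zero g).symm
    | tmul x y => exact h x y
    | add x y hx hy => simp only [UniformSpace.Completion.coe_add, map_add, hx, hy]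

/-- A linear map on the algebraic tensor product that preserves scalar products of elementary
tensors extends to an isometry of the Hilbert space tensor product. -/
def liftIsometry {G : Type*} [NormedAddCommGroup G] [InnerProductSpace ℂ G] [CompleteSpace G]
    (B : E →ₗ[ℂ] F →ₗ[ℂ] G)
    (hB : ∀ x x' y y', ⟪B x y, B x' y'⟫_ℂ = ⟪x, x'⟫_ℂ * ⟪y, y'⟫_ℂ) : HTensor E F →ₗᵢ[ℂ] G where
  toLinearMap := (((TensorProduct.lift B).isometryOfInner (fun z z' => by
    induction z using TensorProduct.induction_on with
    | zero => rw [map_zero, inner_zero_left, inner_zero_left]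
    | add x y hx hy => rw [map_add, inner_add_left, inner_add_left, hx, hy]
    | tmul h f =>
      induction z' using TensorProduct.induction_on with
      | zero => rw [map_zero, inner_zero_right, inner_zero_right]
      | add x y hx hy => rw [map_add, inner_add_right, inner_add_right, hx, hy]
      | tmul h' f' =>
        rw [TensorProduct.lift.tmul, TensorProduct.lift.tmul, hB,
          TensorProduct.inner_tmul])).toContinuousLinearMap.fromCompletion).toLinearMap
  norm_map' z := by
    induction z using UniformSpace.Completion.induction_on with
    | hp =>
      exact isClosed_eq (continuous_norm.comp (ContinuousLinearMap.continuous _)) continuous_norm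
    | ih z =>
      rw [UniformSpace.Completion.norm_coe]
      refine (congrArg norm (ContinuousLinearMap.fromCompletion_apply_coe _ z)).trans ?_
      exact LinearIsometry.norm_map _ z

theorem liftIsometry_htmul {G : Type*} [NormedAddCommGroup G] [InnerProductSpace ℂ G]
    [CompleteSpace G] (B : E →ₗ[ℂ] F →ₗ[ℂ] G)
    (hB : ∀ x x' y y', ⟪B x y, B x' y'⟫_ℂ = ⟪x, x'⟫_ℂ * ⟪y, y'⟫_ℂ) (x : E) (y : F) :
    liftIsometry B hB (htmul x y) = B x y :=
  ContinuousLinearMap.fromCompletion_apply_coe _ _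

variable (F) in
/-- The amplification `T ⊗ id` of a bounded operator `T`. -/
def amplify (T : E →L[ℂ] E') : HTensor E F →L[ℂ] HTensor E' F :=
  (T.rTensor F).completion

theorem amplify_htmul (T : E →L[ℂ] E') (x : E) (y : F) :
    amplify F T (htmul x y) = htmul (T x) y := by
  simp [amplify, htmul]

theorem amplify_comp (T : E' →L[ℂ] E'') (S : E →L[ℂ] E') :
    amplify F (T ∘L S) = amplify F T ∘L amplify F S :=
  htensor_ext fun x y => by simp [amplify_htmul]

theorem inner_amplify [CompleteSpace E] [CompleteSpace E'] (T : E →L[ℂ] E')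
    (z : HTensor E' F) (z' : HTensor E F) :
    ⟪amplify F (ContinuousLinearMap.adjoint T) z, z'⟫_ℂ = ⟪z, amplify F T z'⟫_ℂ := by
  induction z, z' using UniformSpace.Completion.induction_on₂ with
  | hp => exact isClosed_eq (by fun_prop) (by fun_prop)
  | ih z z' =>
    induction z using TensorProduct.induction_on with
    | zero => rw [UniformSpace.Completion.coe_zero, map_zero, inner_zero_left, inner_zero_left]
    | add x y hx hy =>
      simp only [UniformSpace.Completion.coe_add, map_add, inner_add_left, hx, hy]
    | tmul x y =>
      induction z' using TensorProduct.induction_on with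
      | zero => rw [UniformSpace.Completion.coe_zero, map_zero, inner_zero_right, inner_zero_right]
      | add x y hx hy =>
        simp only [UniformSpace.Completion.coe_add, map_add, inner_add_right, hx, hy]
      | tmul x' y' =>
        change ⟪amplify F _ (htmul x y), htmul x' y'⟫_ℂ = ⟪htmul x y, amplify F T (htmul x' y')⟫_ℂ
        rw [amplify_htmul, amplify_htmul, inner_htmul, inner_htmul,
          ContinuousLinearMap.adjoint_inner_left]

/-- The operator `e (T ⊗ id) e⁻¹`, for a unitary `e` from a Hilbert space tensor product. -/
def conjAmplify {G : Type*} [NormedAddCommGroup G] [InnerProductSpace ℂ G]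
    (e : HTensor E F ≃ₗᵢ[ℂ] G) (T : E →L[ℂ] E) : G →L[ℂ] G :=
  e.toContinuousLinearEquiv.toContinuousLinearMap ∘L amplify F T ∘L
    e.symm.toContinuousLinearEquiv.toContinuousLinearMap

theorem conjAmplify_apply {G : Type*} [NormedAddCommGroup G] [InnerProductSpace ℂ G]
    (e : HTensor E F ≃ₗᵢ[ℂ] G) (T : E →L[ℂ] E) (z : HTensor E F) :
    conjAmplify e T (e z) = e (amplify F T z) :=
  congrArg (fun z => e (amplify F T z)) (e.symm_apply_apply z)

theorem conjAmplify_star {G : Type*} [NormedAddCommGroup G] [InnerProductSpace ℂ G]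
    [CompleteSpace E] [CompleteSpace G]
    (e : HTensor E F ≃ₗᵢ[ℂ] G) (T : E →L[ℂ] E) :
    conjAmplify e (star T) = star (conjAmplify e T) := by
  rw [ContinuousLinearMap.star_eq_adjoint, ContinuousLinearMap.star_eq_adjoint,
    ContinuousLinearMap.eq_adjoint_iff]
  intro f g
  obtain ⟨z, rfl⟩ := e.surjective f
  obtain ⟨z', rfl⟩ := e.surjective g
  rw [conjAmplify_apply, conjAmplify_apply, LinearIsometryEquiv.inner_map_map,
    LinearIsometryEquiv.inner_map_map, inner_amplify]

end HilbertTensor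

/-! ### The free product of Hilbert spaces -/

/-- A complex Hilbert space bundled with its carrier, used to define iterated tensor products. -/
structure HilbertBundle : Type (u + 1) where
  carrier : Type u
  [toNormedAddCommGroup : NormedAddCommGroup carrier]
  [toInnerProductSpace : InnerProductSpace ℂ carrier]
  [toCompleteSpace : CompleteSpace carrier]

attribute [instance] HilbertBundle.toNormedAddCommGroup HilbertBundle.toInnerProductSpace
  HilbertBundle.toCompleteSpace

section FreeProduct

variable {I : Type v} {H : I → Type u} [∀ i, NormedAddCommGroup (H i)]
  [∀ i, InnerProductSpace ℂ (H i)]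

/-- The orthogonal complement `H° i = H i ⊖ ℂ ξ i`. -/
abbrev Centered (ξ : ∀ i, H i) (i : I) : Submodule ℂ (H i) := (ℂ ∙ ξ i)ᗮ

/-- `tensorWord ξ [i₁, …, iₙ]` is `H° i₁ ⊗ (H° i₂ ⊗ (⋯ ⊗ (H° iₙ ⊗ ℂ)))`, with value `ℂ` on the
empty word (written as a one-dimensional Euclidean space for universe reasons). -/
def tensorWord (ξ : ∀ i, H i) : List I → HilbertBundle.{u}
  | [] => ⟨EuclideanSpace ℂ PUnit.{u + 1}⟩
  | i :: l => ⟨HTensor (Centered ξ i) (tensorWord ξ l).carrier⟩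

/-- The Hilbert space `H° i₁ ⊗ ⋯ ⊗ H° iₙ` of a word `[i₁, …, iₙ]`. -/
abbrev TW (ξ : ∀ i, H i) (l : List I) : Type u := (tensorWord ξ l).carrier

/-- The unit vector `1` of the summand `ℂ` at the empty word. -/
def emptyVec (ξ : ∀ i, H i) : TW ξ [] :=
  (EuclideanSpace.single PUnit.unit 1 : EuclideanSpace ℂ PUnit.{u + 1})

theorem norm_emptyVec (ξ : ∀ i, H i) : ‖emptyVec ξ‖ = 1 :=
  (PiLp.norm_single (p := 2) (fun _ : PUnit.{u + 1} => ℂ) PUnit.unit 1).trans norm_one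

/-- The elementary tensor `x ⊗ t`, with `x` in `H° i` and `t` in `H° i₁ ⊗ ⋯ ⊗ H° iₙ`. -/
def wcons (ξ : ∀ i, H i) (i : I) (l : List I) (x : Centered ξ i) (t : TW ξ l) : TW ξ (i :: l) :=
  htmul x t

theorem inner_wcons (ξ : ∀ i, H i) (i : I) (l : List I) (x x' : Centered ξ i) (t t' : TW ξ l) :
    ⟪wcons ξ i l x t, wcons ξ i l x' t'⟫_ℂ = ⟪x, x'⟫_ℂ * ⟪t, t'⟫_ℂ :=
  inner_htmul _ _ _ _

theorem norm_wcons (ξ : ∀ i, H i) (i : I) (l : List I) (x : Centered ξ i) (t : TW ξ l) :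
    ‖wcons ξ i l x t‖ = ‖x‖ * ‖t‖ :=
  norm_htmul _ _

theorem wcons_add_left (ξ : ∀ i, H i) (i : I) (l : List I) (x x' : Centered ξ i) (t : TW ξ l) :
    wcons ξ i l (x + x') t = wcons ξ i l x t + wcons ξ i l x' t :=
  htmul_add_left _ _ _

theorem wcons_add_right (ξ : ∀ i, H i) (i : I) (l : List I) (x : Centered ξ i) (t t' : TW ξ l) :
    wcons ξ i l x (t + t') = wcons ξ i l x t + wcons ξ i l x t' :=
  htmul_add_right _ _ _

theorem wcons_smul_left (ξ : ∀ i, H i) (i : I) (l : List I) (c : ℂ) (x : Centered ξ i)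
    (t : TW ξ l) : wcons ξ i l (c • x) t = c • wcons ξ i l x t :=
  htmul_smul_left _ _ _

theorem wcons_smul_right (ξ : ∀ i, H i) (i : I) (l : List I) (c : ℂ) (x : Centered ξ i)
    (t : TW ξ l) : wcons ξ i l x (c • t) = c • wcons ξ i l x t :=
  htmul_smul_right _ _ _

theorem wcons_ext (ξ : ∀ i, H i) (i : I) (l : List I) {G : Type*} [NormedAddCommGroup G]
    [NormedSpace ℂ G] {f g : TW ξ (i :: l) →L[ℂ] G}
    (h : ∀ x t, f (wcons ξ i l x t) = g (wcons ξ i l x t)) : f = g :=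
  htensor_ext (E := Centered ξ i) (F := TW ξ l) h

variable (I) in
/-- Words `i₁ ≠ i₂ ≠ ⋯ ≠ iₙ` (neighbouring letters are different), including the empty word. -/
abbrev Word : Type v := {l : List I // l.IsChain (· ≠ ·)}

/-- The free product `ℂ ξ ⊕ ⨁ H° i₁ ⊗ ⋯ ⊗ H° iₙ` over all words `i₁ ≠ ⋯ ≠ iₙ`, as a Hilbert
space direct sum. -/
abbrev FreeProd (ξ : ∀ i, H i) : Type (max u v) := lp (fun w : Word I => TW ξ w.1) 2

/-- The vectors of the free product whose components vanish outside a set `S` of words. -/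
def supported (ξ : ∀ i, H i) (S : Set (List I)) : Submodule ℂ (FreeProd ξ) where
  carrier := {f | ∀ w : Word I, w.1 ∉ S → f w = 0}
  add_mem' hf hg w hw := by simp [hf w hw, hg w hw]
  zero_mem' w hw := by simp
  smul_mem' c f hf w hw := by simp [hf w hw]

theorem isClosed_supported (ξ : ∀ i, H i) (S : Set (List I)) :
    IsClosed (supported ξ S : Set (FreeProd ξ)) := by
  have : (supported ξ S : Set (FreeProd ξ)) =
      ⋂ (w : Word I) (_ : w.1 ∉ S), {f | lp.evalCLM ℂ (fun w : Word I => TW ξ w.1) 2 w f = 0} := by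
    ext f
    simp only [Set.mem_iInter]
    rfl
  rw [this]
  exact isClosed_iInter fun w => isClosed_iInter fun _ =>
    isClosed_eq (ContinuousLinearMap.continuous _) continuous_const

instance (ξ : ∀ i, H i) (S : Set (List I)) : CompleteSpace (supported ξ S) :=
  (isClosed_supported ξ S).completeSpace_coe

/-- The subspace spanned by `ξ` and by the words with first letter different from `i`. -/
abbrev FreeProdNot (ξ : ∀ i, H i) (i : I) : Submodule ℂ (FreeProd ξ) :=
  supported ξ {l | l.head? ≠ some i}

variable [DecidableEq I]

/-- The vector `t` of the direct summand at the word `w`, as a vector of the free product. -/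
def wordVec (ξ : ∀ i, H i) (w : Word I) (t : TW ξ w.1) : FreeProd ξ :=
  lp.single (E := fun w : Word I => TW ξ w.1) 2 w t

theorem wordVec_self (ξ : ∀ i, H i) (w : Word I) (t : TW ξ w.1) : wordVec ξ w t w = t :=
  lp.single_apply_self (E := fun w : Word I => TW ξ w.1) 2 w t

theorem wordVec_ne (ξ : ∀ i, H i) (w : Word I) (t : TW ξ w.1) {w' : Word I} (h : w' ≠ w) :
    wordVec ξ w t w' = 0 :=
  lp.single_apply_ne (E := fun w : Word I => TW ξ w.1) 2 w t h

theorem inner_wordVec (ξ : ∀ i, H i) (w : Word I) (t : TW ξ w.1) (f : FreeProd ξ) :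
    ⟪wordVec ξ w t, f⟫_ℂ = ⟪t, f w⟫_ℂ :=
  lp.inner_single_left (G := fun w : Word I => TW ξ w.1) w t f

/-- The vacuum vector `ξ`. -/
def vacuum (ξ : ∀ i, H i) : FreeProd ξ :=
  wordVec ξ ⟨[], .nil⟩ (emptyVec ξ)

/-- The components of `x ⊗ f`. -/
def prependFun (ξ : ∀ i, H i) (i : I) (x : Centered ξ i) (f : FreeProd ξ) :
    ∀ w : Word I, TW ξ w.1
  | ⟨[], _⟩ => 0
  | ⟨j :: l, h⟩ => wcons ξ j l (Pi.single (M := fun j => Centered ξ j) i x j) (f ⟨l, h.tail⟩)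

/-- The words with first letter different from `i`. -/
abbrev NotHead (i : I) : Type v := {w : Word I // w.1.head? ≠ some i}

/-- The word `i :: w`. -/
def consWord (i : I) (w : NotHead i) : Word I :=
  ⟨i :: w.1.1, by
    obtain ⟨⟨l, hl⟩, hw⟩ := w
    cases l with
    | nil => exact .singleton i
    | cons j l => exact .cons_cons (fun h => hw (by simp [h])) hl⟩

theorem consWord_injective (i : I) : Function.Injective (consWord i) := by
  rintro ⟨⟨l, hl⟩, hw⟩ ⟨⟨l', hl'⟩, hw'⟩ h
  simpa [consWord] using h

/-- The elementary tensor `x ⊗ t` at the word `i :: w`. -/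
def consVec (ξ : ∀ i, H i) (i : I) (w : NotHead i) (x : Centered ξ i) (t : TW ξ w.1.1) :
    TW ξ (consWord i w).1 :=
  wcons ξ i w.1.1 x t

theorem consVec_zero (ξ : ∀ i, H i) (i : I) (w : NotHead i) (x : Centered ξ i) :
    consVec ξ i w x 0 = 0 := by
  have := wcons_smul_right ξ i w.1.1 0 x 0
  rwa [zero_smul, zero_smul] at this

theorem prependFun_consWord (ξ : ∀ i, H i) (i : I) (x : Centered ξ i) (f : FreeProd ξ)
    (w : NotHead i) : prependFun ξ i x f (consWord i w) = consVec ξ i w x (f w.1) := by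
  simp [prependFun, consWord, consVec]

theorem prependFun_eq_zero (ξ : ∀ i, H i) (i : I) (x : Centered ξ i) (f : FreeProd ξ)
    (w : Word I) (hw : w.1.head? ≠ some i) : prependFun ξ i x f w = 0 := by
  obtain ⟨l, hl⟩ := w
  cases l with
  | nil => rfl
  | cons j l =>
    have : j ≠ i := fun h => hw (by simp [h])
    have h0 := wcons_smul_left ξ j l 0 0 (f ⟨l, hl.tail⟩)
    rw [zero_smul, zero_smul] at h0
    simp only [prependFun, Pi.single_eq_of_ne this]
    exact h0

theorem mem_range_consWord (i : I) (w : Word I) (hw : w.1.head? = some i) :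
    w ∈ Set.range (consWord i) := by
  obtain ⟨l, hl⟩ := w
  cases l with
  | nil => simp at hw
  | cons j l =>
    obtain rfl : j = i := by simpa using hw
    refine ⟨⟨⟨l, hl.tail⟩, ?_⟩, rfl⟩
    cases l with
    | nil => simp
    | cons k l =>
      have := (List.isChain_cons_cons.1 hl).1
      simpa using this.symm

theorem prependFun_eq_zero_of_notMem (ξ : ∀ i, H i) (i : I) (x : Centered ξ i) (f : FreeProd ξ)
    (w : Word I) (hw : w ∉ Set.range (consWord i)) : prependFun ξ i x f w = 0 :=
  prependFun_eq_zero ξ i x f w fun h => hw (mem_range_consWord i w h)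

theorem memℓp_prependFun (ξ : ∀ i, H i) (i : I) (x : Centered ξ i) (f : FreeProd ξ) :
    Memℓp (prependFun ξ i x f) 2 := by
  apply memℓp_gen
  rw [← (consWord_injective i).summable_iff]
  · have h := ((lp.memℓp f).summable (by norm_num)).comp_injective
      (Subtype.val_injective (p := fun w : Word I => w.1.head? ≠ some i))
    refine (h.mul_left (‖x‖ ^ (2 : ℝ))).congr fun w => ?_
    have e : ‖prependFun ξ i x f (consWord i w)‖ = ‖x‖ * ‖f w.1‖ := by
      rw [prependFun_consWord]
      exact norm_wcons ξ i w.1.1 x (f w.1)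
    rw [Function.comp_apply, Function.comp_apply, e, ENNReal.toReal_ofNat,
      Real.mul_rpow (norm_nonneg _) (norm_nonneg _)]
  · intro w hw
    rw [prependFun_eq_zero_of_notMem ξ i x f w hw]
    simp

/-- The vector `x ⊗ f` of the free product, for `x` in `H° i`; only the components of `f` at words
with first letter different from `i` contribute. -/
def prepend (ξ : ∀ i, H i) (i : I) (x : Centered ξ i) (f : FreeProd ξ) : FreeProd ξ :=
  ⟨prependFun ξ i x f, memℓp_prependFun ξ i x f⟩

theorem prepend_apply (ξ : ∀ i, H i) (i : I) (x : Centered ξ i) (f : FreeProd ξ) (w : Word I) :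
    prepend ξ i x f w = prependFun ξ i x f w :=
  rfl

theorem prepend_add_left (ξ : ∀ i, H i) (i : I) (x x' : Centered ξ i) (f : FreeProd ξ) :
    prepend ξ i (x + x') f = prepend ξ i x f + prepend ξ i x' f := by
  ext1
  funext w
  rw [lp.coeFn_add, Pi.add_apply, prepend_apply, prepend_apply, prepend_apply]
  obtain ⟨l, hl⟩ := w
  cases l with
  | nil => simp [prependFun]
  | cons j l => simp [prependFun, Pi.single_add, wcons_add_left]

theorem prepend_add_right (ξ : ∀ i, H i) (i : I) (x : Centered ξ i) (f f' : FreeProd ξ) :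
    prepend ξ i x (f + f') = prepend ξ i x f + prepend ξ i x f' := by
  ext1
  funext w
  rw [lp.coeFn_add, Pi.add_apply, prepend_apply, prepend_apply, prepend_apply]
  obtain ⟨l, hl⟩ := w
  cases l with
  | nil => simp [prependFun]
  | cons j l => simp [prependFun, wcons_add_right]

theorem prepend_smul_left (ξ : ∀ i, H i) (i : I) (c : ℂ) (x : Centered ξ i) (f : FreeProd ξ) :
    prepend ξ i (c • x) f = c • prepend ξ i x f := by
  ext1
  funext w
  rw [lp.coeFn_smul, Pi.smul_apply, prepend_apply, prepend_apply]
  obtain ⟨l, hl⟩ := w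
  cases l with
  | nil => simp [prependFun]
  | cons j l => simp [prependFun, Pi.single_smul, wcons_smul_left]

theorem prepend_smul_right (ξ : ∀ i, H i) (i : I) (c : ℂ) (x : Centered ξ i) (f : FreeProd ξ) :
    prepend ξ i x (c • f) = c • prepend ξ i x f := by
  ext1
  funext w
  rw [lp.coeFn_smul, Pi.smul_apply, prepend_apply, prepend_apply]
  obtain ⟨l, hl⟩ := w
  cases l with
  | nil => simp [prependFun]
  | cons j l => simp [prependFun, wcons_smul_right]

theorem inner_prepend (ξ : ∀ i, H i) (i : I) (x x' : Centered ξ i) (f f' : FreeProdNot ξ i) :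
    ⟪prepend ξ i x f.1, prepend ξ i x' f'.1⟫_ℂ = ⟪x, x'⟫_ℂ * ⟪f, f'⟫_ℂ := by
  have h1 : ∑' w : Word I, ⟪prepend ξ i x f.1 w, prepend ξ i x' f'.1 w⟫_ℂ =
      ∑' w : NotHead i, ⟪x, x'⟫_ℂ * ⟪f.1 w.1, f'.1 w.1⟫_ℂ := by
    rw [← (consWord_injective i).tsum_eq]
    · refine tsum_congr fun w => ?_
      rw [prepend_apply, prepend_apply, prependFun_consWord, prependFun_consWord]
      exact inner_wcons ξ i w.1.1 x x' (f.1 w.1) (f'.1 w.1)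
    · intro w hw
      by_contra hc
      refine hw ?_
      simp only [prepend_apply, prependFun_eq_zero_of_notMem ξ i x f.1 w hc, inner_zero_left]
  have h2 : ∑' w : Word I, ⟪f.1 w, f'.1 w⟫_ℂ = ∑' w : NotHead i, ⟪f.1 w.1, f'.1 w.1⟫_ℂ := by
    rw [← (Subtype.val_injective (p := fun w : Word I => w.1.head? ≠ some i)).tsum_eq]
    intro w hw
    by_contra hc
    refine hw ?_
    have : f.1 w = 0 := f.2 w fun h => hc ⟨⟨w, h⟩, rfl⟩
    simp only [this, inner_zero_left]
  calc ⟪prepend ξ i x f.1, prepend ξ i x' f'.1⟫_ℂ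
      = ∑' w : Word I, ⟪prepend ξ i x f.1 w, prepend ξ i x' f'.1 w⟫_ℂ := lp.inner_eq_tsum _ _
    _ = ⟪x, x'⟫_ℂ * ∑' w : Word I, ⟪f.1 w, f'.1 w⟫_ℂ := by rw [h1, h2, tsum_mul_left]
    _ = ⟪x, x'⟫_ℂ * ⟪f, f'⟫_ℂ := by rw [Submodule.coe_inner _ f f', lp.inner_eq_tsum]

theorem inner_prepend_right (ξ : ∀ i, H i) (i : I) (x : Centered ξ i) (f : FreeProdNot ξ i)
    (g : FreeProd ξ) : ⟪f.1, prepend ξ i x g⟫_ℂ = 0 := by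
  rw [lp.inner_eq_tsum]
  refine (tsum_congr fun w => ?_).trans tsum_zero
  rw [prepend_apply]
  by_cases h : w.1.head? = some i
  · rw [f.2 w (by simpa using h), inner_zero_left]
  · rw [prependFun_eq_zero ξ i x g w h, inner_zero_right]

theorem inner_prepend_left (ξ : ∀ i, H i) (i : I) (x : Centered ξ i) (f : FreeProdNot ξ i)
    (g : FreeProd ξ) : ⟪prepend ξ i x g, f.1⟫_ℂ = 0 := by
  rw [← inner_conj_symm, inner_prepend_right, map_zero]

theorem inner_decomp (ξ : ∀ i, H i) (hξ : ∀ i, ‖ξ i‖ = 1) (i : I) (h h' : H i) :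
    ⟪h, h'⟫_ℂ = ⟪h, ξ i⟫_ℂ * ⟪ξ i, h'⟫_ℂ +
      ⟪(Centered ξ i).orthogonalProjectionOnto h, (Centered ξ i).orthogonalProjectionOnto h'⟫_ℂ := by
  have e := (ℂ ∙ ξ i).starProjection_add_starProjection_orthogonal h
  rw [Submodule.starProjection_unit_singleton ℂ (hξ i)] at e
  rw [Submodule.inner_orthogonalProjectionOnto_eq_of_mem_left,
    Submodule.coe_orthogonalProjectionOnto_apply]
  conv_lhs => rw [← e]
  rw [inner_add_left, inner_smul_left, inner_conj_symm]

/-- `(h, f) ↦ ⟪ξ i, h⟫ f + h° ⊗ f`, where `h°` is the component of `h` in `H° i`. Thus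
`(ξ i, f) ↦ f` and `(x, f) ↦ x ⊗ f` for `x` in `H° i`. -/
def gluePre (ξ : ∀ i, H i) (i : I) : H i →ₗ[ℂ] FreeProdNot ξ i →ₗ[ℂ] FreeProd ξ :=
  LinearMap.mk₂ ℂ
    (fun (h : H i) (f : FreeProdNot ξ i) =>
      ⟪ξ i, h⟫_ℂ • f.1 + prepend ξ i ((Centered ξ i).orthogonalProjectionOnto h) f.1)
    (fun h h' f => by rw [inner_add_right, map_add, prepend_add_left, add_smul]; abel)
    (fun c h f => by
      rw [inner_smul_right, map_smul, prepend_smul_left, smul_add, smul_smul])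
    (fun h f f' => by rw [Submodule.coe_add, smul_add, prepend_add_right]; abel)
    (fun c h f => by
      rw [Submodule.coe_smul, prepend_smul_right, smul_add, smul_comm])

theorem gluePre_apply (ξ : ∀ i, H i) (i : I) (h : H i) (f : FreeProdNot ξ i) :
    gluePre ξ i h f =
      ⟪ξ i, h⟫_ℂ • f.1 + prepend ξ i ((Centered ξ i).orthogonalProjectionOnto h) f.1 :=
  rfl

theorem inner_gluePre (ξ : ∀ i, H i) (hξ : ∀ i, ‖ξ i‖ = 1) (i : I) (h h' : H i)
    (f f' : FreeProdNot ξ i) :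
    ⟪gluePre ξ i h f, gluePre ξ i h' f'⟫_ℂ = ⟪h, h'⟫_ℂ * ⟪f, f'⟫_ℂ := by
  rw [gluePre_apply, gluePre_apply, inner_add_left, inner_add_right, inner_add_right,
    inner_smul_left, inner_smul_left, inner_smul_right, inner_smul_right,
    inner_prepend_right, inner_prepend_left, inner_prepend,
    inner_decomp ξ hξ i h h', inner_conj_symm, Submodule.coe_inner _ f f']
  ring

/-- The isometry `V i : H i ⊗ FreeProdNot ξ i → FreeProd ξ`, the continuous linear extension of
`h ⊗ f ↦ ⟪ξ i, h⟫ f + h° ⊗ f`. -/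
def glueIsometry (ξ : ∀ i, H i) (hξ : ∀ i, ‖ξ i‖ = 1) (i : I) :
    HTensor (H i) (FreeProdNot ξ i) →ₗᵢ[ℂ] FreeProd ξ :=
  liftIsometry (gluePre ξ i) (inner_gluePre ξ hξ i)

theorem glueIsometry_htmul (ξ : ∀ i, H i) (hξ : ∀ i, ‖ξ i‖ = 1) (i : I) (h : H i)
    (f : FreeProdNot ξ i) : glueIsometry ξ hξ i (htmul h f) =
      ⟪ξ i, h⟫_ℂ • f.1 + prepend ξ i ((Centered ξ i).orthogonalProjectionOnto h) f.1 :=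
  liftIsometry_htmul _ _ _ _

theorem eq_top_of_wordVec_mem (ξ : ∀ i, H i) (K : Submodule ℂ (FreeProd ξ))
    (hK : IsClosed (K : Set (FreeProd ξ)))
    (h : ∀ (w : Word I) (t : TW ξ w.1), wordVec ξ w t ∈ K) : K = ⊤ := by
  refine eq_top_iff.2 fun f _ => ?_
  exact hK.mem_of_tendsto (lp.hasSum_single (by norm_num) f)
    (Filter.Eventually.of_forall fun s => K.sum_mem fun w _ => h w (f w))

theorem wordVec_mem_FreeProdNot (ξ : ∀ i, H i) (i : I) (w : NotHead i)
    (t : TW ξ w.1.1) : wordVec ξ w.1 t ∈ FreeProdNot ξ i := by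
  intro w' hw'
  refine wordVec_ne ξ w.1 t ?_
  rintro rfl
  exact hw' w.2

theorem prepend_wordVec (ξ : ∀ i, H i) (i : I) (x : Centered ξ i) (w : NotHead i)
    (t : TW ξ w.1.1) : prepend ξ i x (wordVec ξ w.1 t) =
      wordVec ξ (consWord i w) (consVec ξ i w x t) := by
  ext1
  funext w'
  rw [prepend_apply]
  by_cases h : w' ∈ Set.range (consWord i)
  · obtain ⟨w', rfl⟩ := h
    rw [prependFun_consWord]
    by_cases e : w' = w
    · subst e
      rw [wordVec_self, wordVec_self]
    · rw [wordVec_ne _ _ _ (fun h => e (Subtype.ext h)),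
        wordVec_ne _ _ _ (fun h => e (consWord_injective i h))]
      exact consVec_zero ξ i w' x
  · rw [prependFun_eq_zero_of_notMem _ _ _ _ _ h, wordVec_ne]
    rintro rfl
    exact h ⟨w, rfl⟩

theorem glueIsometry_surjective (ξ : ∀ i, H i) (hξ : ∀ i, ‖ξ i‖ = 1) (i : I) :
    Function.Surjective (glueIsometry ξ hξ i) := by
  have hcl : IsClosed ((glueIsometry ξ hξ i).toLinearMap.range : Set (FreeProd ξ)) := by
    rw [LinearMap.coe_range]
    exact (glueIsometry ξ hξ i).isometry.isClosedEmbedding.isClosed_range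
  rw [← LinearIsometry.coe_toLinearMap, ← LinearMap.range_eq_top]
  refine eq_top_of_wordVec_mem ξ _ hcl fun w t => ?_
  have hP : (Centered ξ i).orthogonalProjectionOnto (ξ i) = 0 :=
    Submodule.orthogonalProjectionOnto_orthogonal_apply_eq_zero
      (Submodule.mem_span_singleton_self (ξ i))
  by_cases hw : w.1.head? = some i
  · obtain ⟨w, rfl⟩ := mem_range_consWord i w hw
    set K : Submodule ℂ (FreeProd ξ) := (glueIsometry ξ hξ i).toLinearMap.range
    have : CompleteSpace K := hcl.completeSpace_coe
    let L : TW ξ (i :: w.1.1) →L[ℂ] FreeProd ξ :=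
      lp.singleContinuousLinearMap ℂ (fun w : Word I => TW ξ w.1) 2 (consWord i w)
    have hQ : Kᗮ.starProjection ∘L L = 0 := by
      refine wcons_ext ξ i w.1.1 fun x t => ?_
      refine Submodule.starProjection_orthogonal_apply_eq_zero ?_
      refine ⟨htmul (x : H i) ⟨wordVec ξ w.1 t, wordVec_mem_FreeProdNot ξ i w t⟩, ?_⟩
      have hx : ⟪ξ i, (x : H i)⟫_ℂ = 0 := Submodule.mem_orthogonal_singleton_iff_inner_right.1 x.2
      rw [LinearIsometry.coe_toLinearMap, glueIsometry_htmul, hx, zero_smul, zero_add,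
        Submodule.orthogonalProjectionOnto_mem_subspace_eq_self, prepend_wordVec]
      rfl
    have h1 : Kᗮ.starProjection (wordVec ξ (consWord i w) t) = 0 := DFunLike.congr_fun hQ t
    rwa [Submodule.starProjection_apply_eq_zero_iff, Submodule.orthogonal_orthogonal] at h1
  · refine ⟨htmul (ξ i) ⟨wordVec ξ w t, wordVec_mem_FreeProdNot ξ i ⟨w, hw⟩ t⟩, ?_⟩
    rw [LinearIsometry.coe_toLinearMap, glueIsometry_htmul, hP, inner_self_eq_norm_sq_to_K, hξ i]
    have h0 := prepend_smul_left ξ i 0 0 (wordVec ξ w t)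
    rw [zero_smul, zero_smul] at h0
    simp [h0]

/-- The unitary `V i : H i ⊗ FreeProdNot ξ i → FreeProd ξ`, which sends `ξ i ⊗ f` to `f` and `x ⊗ f`
to `x ⊗ f` (in the summands with first letter `i`) for `x` in `H° i`. -/
def glue (ξ : ∀ i, H i) (hξ : ∀ i, ‖ξ i‖ = 1) (i : I) :
    HTensor (H i) (FreeProdNot ξ i) ≃ₗᵢ[ℂ] FreeProd ξ :=
  LinearIsometryEquiv.ofSurjective (glueIsometry ξ hξ i) (glueIsometry_surjective ξ hξ i)

theorem glue_htmul (ξ : ∀ i, H i) (hξ : ∀ i, ‖ξ i‖ = 1) (i : I) (h : H i)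
    (f : FreeProdNot ξ i) : glue ξ hξ i (htmul h f) =
      ⟪ξ i, h⟫_ℂ • f.1 + prepend ξ i ((Centered ξ i).orthogonalProjectionOnto h) f.1 :=
  glueIsometry_htmul ξ hξ i h f

/-- The left representation `λ i (T) = V i (T ⊗ id) (V i)⁻¹` on the free product. -/
def leftRep (ξ : ∀ i, H i) (hξ : ∀ i, ‖ξ i‖ = 1) (i : I) (T : H i →L[ℂ] H i) :
    FreeProd ξ →L[ℂ] FreeProd ξ :=
  conjAmplify (glue ξ hξ i) T

theorem leftRep_glue (ξ : ∀ i, H i) (hξ : ∀ i, ‖ξ i‖ = 1) (i : I) (T : H i →L[ℂ] H i)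
    (z : HTensor (H i) (FreeProdNot ξ i)) :
    leftRep ξ hξ i T (glue ξ hξ i z) = glue ξ hξ i (amplify (FreeProdNot ξ i) T z) :=
  conjAmplify_apply (glue ξ hξ i) T z

theorem leftRep_ext (ξ : ∀ i, H i) (hξ : ∀ i, ‖ξ i‖ = 1) (i : I)
    {A B : FreeProd ξ →L[ℂ] FreeProd ξ}
    (h : ∀ (x : H i) (f : FreeProdNot ξ i),
      A (glue ξ hξ i (htmul x f)) = B (glue ξ hξ i (htmul x f))) : A = B := by
  have := htensor_ext (f := A ∘L (glue ξ hξ i).toContinuousLinearEquiv.toContinuousLinearMap)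
    (g := B ∘L (glue ξ hξ i).toContinuousLinearEquiv.toContinuousLinearMap) h
  ext1 f
  obtain ⟨z, rfl⟩ := (glue ξ hξ i).surjective f
  exact DFunLike.congr_fun this z

theorem leftRep_add (ξ : ∀ i, H i) (hξ : ∀ i, ‖ξ i‖ = 1) (i : I) (T S : H i →L[ℂ] H i) :
    leftRep ξ hξ i (T + S) = leftRep ξ hξ i T + leftRep ξ hξ i S :=
  leftRep_ext ξ hξ i fun x f => by
    simp only [add_apply, leftRep_glue, amplify_htmul, htmul_add_left, map_add]

theorem leftRep_smul (ξ : ∀ i, H i) (hξ : ∀ i, ‖ξ i‖ = 1) (i : I) (c : ℂ) (T : H i →L[ℂ] H i) :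
    leftRep ξ hξ i (c • T) = c • leftRep ξ hξ i T :=
  leftRep_ext ξ hξ i fun x f => by
    simp only [smul_apply, leftRep_glue, amplify_htmul, htmul_smul_left,
      map_smul]

theorem leftRep_mul (ξ : ∀ i, H i) (hξ : ∀ i, ‖ξ i‖ = 1) (i : I) (T S : H i →L[ℂ] H i) :
    leftRep ξ hξ i (T * S) = leftRep ξ hξ i T * leftRep ξ hξ i S :=
  leftRep_ext ξ hξ i fun x f => by
    simp only [mul_apply_eq_comp, leftRep_glue, amplify_htmul]

theorem leftRep_star [∀ i, CompleteSpace (H i)] (ξ : ∀ i, H i) (hξ : ∀ i, ‖ξ i‖ = 1) (i : I)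
    (T : H i →L[ℂ] H i) : leftRep ξ hξ i (star T) = star (leftRep ξ hξ i T) :=
  conjAmplify_star (glue ξ hξ i) T

/-- The orthogonal projection onto a subspace `supported ξ S` keeps the components in `S`. -/
theorem starProjection_supported (ξ : ∀ i, H i) (S : Set (List I)) [DecidablePred (· ∈ S)]
    (f : FreeProd ξ) (w : Word I) :
    (supported ξ S).starProjection f w = if w.1 ∈ S then f w else 0 := by
  split_ifs with hw
  · have hmem := Submodule.sub_starProjection_mem_orthogonal (K := supported ξ S) f
    have h0 : (f - (supported ξ S).starProjection f) w = 0 := by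
      rw [← inner_self_eq_zero (𝕜 := ℂ), ← inner_wordVec]
      refine hmem _ fun w' hw' => wordVec_ne _ _ _ ?_
      rintro rfl
      exact hw' hw
    rw [lp.coeFn_sub, Pi.sub_apply, sub_eq_zero] at h0
    exact h0.symm
  · exact Submodule.starProjection_apply_mem (supported ξ S) f w hw

end FreeProduct

/-! ### The V-monotone product of Hilbert spaces -/

section VMonotoneProduct

variable {I : Type v} [LinearOrder I]

/-- The word `l = [i₁, …, iₙ]`, `n ≥ 1`, satisfies `i₁ > ⋯ > iₘ < ⋯ < iₙ` for some `1 ≤ m ≤ n`. -/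
def IsVWord (l : List I) : Prop :=
  ∃ (p : List I) (m : I) (q : List I), l = p ++ m :: q ∧
    (p ++ [m]).IsChain (· > ·) ∧ (m :: q).IsChain (· < ·)

theorem isVWord_singleton (i : I) : IsVWord [i] :=
  ⟨[], i, [], rfl, .singleton i, .singleton i⟩

theorem IsVWord.of_cons {i : I} {l : List I} (hl : l ≠ []) (h : IsVWord (i :: l)) : IsVWord l := by
  obtain ⟨p, m, q, e, hp, hq⟩ := h
  cases p with
  | nil =>
    obtain ⟨rfl, rfl⟩ : i = m ∧ l = q := by simpa using e
    cases l with
    | nil => exact absurd rfl hl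
    | cons j l => exact ⟨[], j, l, rfl, .singleton j, hq.tail⟩
  | cons j p =>
    obtain ⟨rfl, rfl⟩ : i = j ∧ l = p ++ m :: q := by simpa using e
    exact ⟨p, m, q, rfl, hp.tail, hq⟩

variable {H : I → Type u} [∀ i, NormedAddCommGroup (H i)] [∀ i, InnerProductSpace ℂ (H i)]

/-- The V-monotone product `ℂ ξ ⊕ ⨁ H° i₁ ⊗ ⋯ ⊗ H° iₙ` over the words `i₁ > ⋯ > iₘ < ⋯ < iₙ`,
as a closed subspace of the free product. -/
abbrev VProd (ξ : ∀ i, H i) : Submodule ℂ (FreeProd ξ) :=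
  supported ξ {l | l = [] ∨ IsVWord l}

/-- The words of the V-monotone product that start with `i` or can be prolonged by `i` on the left,
and the empty word. -/
def actingWords (i : I) : Set (List I) :=
  {l | l = [] ∨ (IsVWord l ∧ (l.head? = some i ∨ IsVWord (i :: l)))}

/-- The subspace of the V-monotone product on which `H i` acts. -/
abbrev VProdAt (ξ : ∀ i, H i) (i : I) : Submodule ℂ (FreeProd ξ) := supported ξ (actingWords i)

/-- The orthogonal projection `U i` of the free product onto `VProdAt ξ i`. -/
abbrev vProj (ξ : ∀ i, H i) (i : I) : FreeProd ξ →L[ℂ] FreeProd ξ := (VProdAt ξ i).starProjection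

theorem cons_mem_actingWords {i : I} {l : List I} (hl : l.head? ≠ some i) :
    i :: l ∈ actingWords i ↔ l ∈ actingWords i := by
  constructor
  · rintro (h | ⟨h, -⟩)
    · simp at h
    · by_cases e : l = []
      · exact .inl e
      · exact .inr ⟨h.of_cons e, .inr h⟩
  · rintro (rfl | ⟨h, h' | h'⟩)
    · exact .inr ⟨isVWord_singleton i, .inl rfl⟩
    · exact absurd h' hl
    · exact .inr ⟨h', .inl rfl⟩

theorem vProj_mem_FreeProdNot (ξ : ∀ i, H i) (i : I) (f : FreeProdNot ξ i) :
    vProj ξ i f.1 ∈ FreeProdNot ξ i := by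
  classical
  intro w hw
  rw [starProjection_supported, f.2 w hw, ite_self]

theorem vProj_prepend (ξ : ∀ i, H i) (i : I) (x : Centered ξ i) (f : FreeProd ξ) :
    vProj ξ i (prepend ξ i x f) = prepend ξ i x (vProj ξ i f) := by
  classical
  ext1
  funext w
  rw [starProjection_supported, prepend_apply, prepend_apply]
  by_cases h : w ∈ Set.range (consWord i)
  · obtain ⟨w, rfl⟩ := h
    rw [prependFun_consWord, prependFun_consWord, starProjection_supported]
    have e : (consWord i w).1 ∈ actingWords i ↔ w.1.1 ∈ actingWords i := cons_mem_actingWords w.2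
    by_cases hw : w.1.1 ∈ actingWords i
    · rw [if_pos hw, if_pos (e.2 hw)]
    · rw [if_neg hw, if_neg (fun h => hw (e.1 h)), consVec_zero]
  · rw [prependFun_eq_zero_of_notMem _ _ _ _ _ h, prependFun_eq_zero_of_notMem _ _ _ _ _ h,
      ite_self]

theorem vProj_glue (ξ : ∀ i, H i) (hξ : ∀ i, ‖ξ i‖ = 1) (i : I) (h : H i)
    (f : FreeProdNot ξ i) : vProj ξ i (glue ξ hξ i (htmul h f)) =
      glue ξ hξ i (htmul h ⟨vProj ξ i f.1, vProj_mem_FreeProdNot ξ i f⟩) := by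
  rw [glue_htmul, glue_htmul, map_add, map_smul, vProj_prepend]

theorem vProj_leftRep (ξ : ∀ i, H i) (hξ : ∀ i, ‖ξ i‖ = 1) (i : I) (T : H i →L[ℂ] H i) :
    vProj ξ i * leftRep ξ hξ i T = leftRep ξ hξ i T * vProj ξ i :=
  leftRep_ext ξ hξ i fun x f => by
    rw [mul_apply_eq_comp, mul_apply_eq_comp, leftRep_glue, amplify_htmul,
      vProj_glue, vProj_glue, leftRep_glue, amplify_htmul]

theorem vProj_mul_vProj (ξ : ∀ i, H i) (i : I) : vProj ξ i * vProj ξ i = vProj ξ i :=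
  (VProdAt ξ i).isIdempotentElem_starProjection

variable [∀ i, CompleteSpace (H i)]

/-- The V-monotone left representation `T ↦ U i (λ i (T)) U i`, acting on the free product (it
vanishes on the orthogonal complement of the V-monotone product). -/
def vLeftRep (ξ : ∀ i, H i) (hξ : ∀ i, ‖ξ i‖ = 1) (i : I) :
    (H i →L[ℂ] H i) →⋆ₙₐ[ℂ] (FreeProd ξ →L[ℂ] FreeProd ξ) where
  toFun T := vProj ξ i * leftRep ξ hξ i T * vProj ξ i
  map_smul' c T := by simp [leftRep_smul]
  map_zero' := by
    have := leftRep_smul ξ hξ i 0 0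
    rw [zero_smul, zero_smul] at this
    simp [this]
  map_add' T S := by rw [leftRep_add, mul_add, add_mul]
  map_mul' T S := by
    have h := vProj_leftRep ξ hξ i
    have hU := vProj_mul_vProj ξ i
    calc vProj ξ i * leftRep ξ hξ i (T * S) * vProj ξ i
        = vProj ξ i * leftRep ξ hξ i T * (leftRep ξ hξ i S * vProj ξ i) := by
          rw [leftRep_mul]; simp only [mul_assoc]
      _ = vProj ξ i * leftRep ξ hξ i T * ((vProj ξ i * vProj ξ i) * leftRep ξ hξ i S * vProj ξ i) := by
          rw [hU, h S, mul_assoc _ (vProj ξ i), hU]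
      _ = _ := by simp only [mul_assoc]
  map_star' T := by
    have hU : star (vProj ξ i) = vProj ξ i := isSelfAdjoint_starProjection (VProdAt ξ i)
    rw [star_mul, star_mul, hU, leftRep_star, mul_assoc]

theorem vProj_mem_VProd (ξ : ∀ i, H i) (i : I) (f : FreeProd ξ) : vProj ξ i f ∈ VProd ξ := by
  intro w hw
  refine Submodule.starProjection_apply_mem (VProdAt ξ i) f w fun h => hw ?_
  rcases h with h | h
  · exact .inl h
  · exact .inr h.1

theorem vLeftRep_mem_VProd (ξ : ∀ i, H i) (hξ : ∀ i, ‖ξ i‖ = 1) (i : I) (T : H i →L[ℂ] H i)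
    (f : FreeProd ξ) : vLeftRep ξ hξ i T f ∈ VProd ξ :=
  vProj_mem_VProd ξ i _

/-- The restriction of `vLeftRep ξ hξ i T` to the invariant subspace `VProd ξ`. -/
def vRestrict (ξ : ∀ i, H i) (hξ : ∀ i, ‖ξ i‖ = 1) (i : I) (T : H i →L[ℂ] H i) :
    VProd ξ →L[ℂ] VProd ξ :=
  ((vLeftRep ξ hξ i T) ∘L (VProd ξ).subtypeL).codRestrict (VProd ξ)
    fun f => vLeftRep_mem_VProd ξ hξ i T f

theorem coe_vRestrict (ξ : ∀ i, H i) (hξ : ∀ i, ‖ξ i‖ = 1) (i : I) (T : H i →L[ℂ] H i)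
    (f : VProd ξ) : (vRestrict ξ hξ i T f : FreeProd ξ) = vLeftRep ξ hξ i T f.1 :=
  rfl

/-- The V-monotone left representation on the V-monotone product itself. -/
def vLeftRepOn (ξ : ∀ i, H i) (hξ : ∀ i, ‖ξ i‖ = 1) (i : I) :
    (H i →L[ℂ] H i) →⋆ₙₐ[ℂ] (VProd ξ →L[ℂ] VProd ξ) where
  toFun T := vRestrict ξ hξ i T
  map_smul' c T := by ext1 f; apply Subtype.ext; simp [coe_vRestrict]
  map_zero' := by ext1 f; apply Subtype.ext; simp [coe_vRestrict]
  map_add' T S := by ext1 f; apply Subtype.ext; simp [coe_vRestrict]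
  map_mul' T S := by ext1 f; apply Subtype.ext; simp [coe_vRestrict]
  map_star' T := by
    rw [ContinuousLinearMap.star_eq_adjoint (vRestrict ξ hξ i T),
      ContinuousLinearMap.eq_adjoint_iff]
    intro f g
    change ⟪vLeftRep ξ hξ i (star T) f.1, g.1⟫_ℂ = ⟪f.1, vLeftRep ξ hξ i T g.1⟫_ℂ
    rw [map_star, ContinuousLinearMap.star_eq_adjoint, ContinuousLinearMap.adjoint_inner_left]

theorem vacuum_mem_VProd (ξ : ∀ i, H i) : vacuum ξ ∈ VProd ξ := by
  intro w hw
  refine wordVec_ne ξ _ _ ?_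
  rintro rfl
  exact hw (.inl rfl)

/-- The vacuum vector as an element of the V-monotone product. -/
def vVacuum (ξ : ∀ i, H i) : VProd ξ := ⟨vacuum ξ, vacuum_mem_VProd ξ⟩

end VMonotoneProduct

/-! ### States and V-monotone independence -/

/-- A state on a unital `*`-algebra: a positive linear functional with `φ 1 = 1`. -/
structure IsState {A : Type*} [Ring A] [StarRing A] [Algebra ℂ A] (φ : A →ₗ[ℂ] ℂ) : Prop where
  map_one : φ 1 = 1
  nonneg : ∀ a, 0 ≤ φ (star a * a)

/-- The vector functional `T ↦ ⟨T Ω, Ω⟩`; Mathlib's scalar product is linear in the second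
variable. -/
def vectorState {K : Type*} [NormedAddCommGroup K] [InnerProductSpace ℂ K] (Ω : K) :
    (K →L[ℂ] K) →ₗ[ℂ] ℂ where
  toFun T := ⟪Ω, T Ω⟫_ℂ
  map_add' T S := by rw [add_apply, inner_add_right]
  map_smul' c T := by rw [smul_apply, inner_smul_right]; rfl

/-- V-monotone independence of a family of (not necessarily unital) subalgebras `B i` of a unital
algebra `A` with respect to a linear functional `φ`. Here `e i` is the inner unit of `B i`. A word
`a₁ ⋯ aₙ` with `aₖ ∈ B iₖ` is given by the list of the pairs `(iₖ, aₖ)`. -/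
def IsVMonotoneIndependent {I : Type*} [LinearOrder I] {A : Type*} [Ring A] [Algebra ℂ A]
    (φ : A →ₗ[ℂ] ℂ) (B : I → NonUnitalSubalgebra ℂ A) : Prop :=
  ∃ e : I → A,
    (∀ i, e i ∈ B i ∧ ∀ a ∈ B i, e i * a = a ∧ a * e i = a) ∧
    (∀ i, φ (e i) = 1) ∧
    -- the freeness condition
    (∀ l : List (I × A), l ≠ [] → (l.map Prod.fst).IsChain (· ≠ ·) → (∀ x ∈ l, x.2 ∈ B x.1) →
      (∀ x ∈ l, φ x.2 = 0) → φ (l.map Prod.snd).prod = 0) ∧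
    -- the unit condition, where `p = (a₁, …, aⱼ₋₁)`, `x = (iⱼ, aⱼ)` and `q = (aⱼ₊₁, …, aₙ)`,
    -- so that `j = p.length + 1`
    (∀ (p q : List (I × A)) (x : I × A) (r : ℕ),
      ((p ++ x :: q).map Prod.fst).IsChain (· ≠ ·) →
      (∀ y ∈ p ++ x :: q, y.2 ∈ B y.1) →
      (∀ y ∈ p, φ y.2 = 0) →
      1 ≤ r → r ≤ (p ++ x :: q).length →
      IsVWord (((p ++ x :: q).map Prod.fst).take r) →
      (r < (p ++ x :: q).length → ¬ IsVWord (((p ++ x :: q).map Prod.fst).take (r + 1))) →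
      φ ((p.map Prod.snd).prod * e x.1 * (q.map Prod.snd).prod) =
        if p.length + 1 ≤ r then φ ((p.map Prod.snd).prod * (q.map Prod.snd).prod) else 0)

/-! ### The free product of C⋆-algebras without identification of units -/

section FreeProductAlgebra

variable {I : Type v} (A : I → Type u) [∀ i, CStarAlgebra (A i)]

/-- A family of (not necessarily unital) `*`-homomorphisms from the algebras `A i` to a common
nonzero unital C⋆-algebra. -/
structure JointRep : Type (max u v (w + 1)) where
  target : Type w
  [toCStarAlgebra : CStarAlgebra target]
  [toNontrivial : Nontrivial target]
  rep : ∀ i, A i →⋆ₙₐ[ℂ] target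

attribute [instance] JointRep.toCStarAlgebra JointRep.toNontrivial

/-- The bounded families of elements of the targets of all joint representations. -/
abbrev JointRepProd : Type (max u v (w + 1)) :=
  lp (fun R : JointRep.{u, v, w} A => R.target) ∞

instance : NormedRing (JointRepProd.{u, v, w} A) := inferInstance

instance : NormedAlgebra ℂ (JointRepProd.{u, v, w} A) := inferInstance

instance : StarRing (JointRepProd.{u, v, w} A) := inferInstance

instance : StarModule ℂ (JointRepProd.{u, v, w} A) := inferInstance

variable {A} in
/-- The element of `JointRepProd A` given by the images of `a ∈ A i` in all joint
representations. -/
def jointImage (i : I) : A i →⋆ₙₐ[ℂ] JointRepProd.{u, v, w} A where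
  toFun a := ⟨fun R => R.rep i a, memℓp_infty ⟨‖a‖, by
    rintro _ ⟨R, rfl⟩
    exact NonUnitalStarAlgHom.norm_apply_le (R.rep i) a⟩⟩
  map_smul' c a := by ext1; funext R; exact map_smul (R.rep i) c a
  map_zero' := by ext1; funext R; exact map_zero (R.rep i)
  map_add' a b := by ext1; funext R; exact map_add (R.rep i) a b
  map_mul' a b := by ext1; funext R; exact map_mul (R.rep i) a b
  map_star' a := by ext1; funext R; exact map_star (R.rep i) a

/-- The free product of the C⋆-algebras `A i` without identification of units, with a unit adjoined:
the C⋆-algebra generated by `1` and by the images of the `A i` in the product of all joint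
representations. -/
def freeProdAlg : StarSubalgebra ℂ (JointRepProd.{u, v, w} A) :=
  (StarAlgebra.adjoin ℂ (⋃ i, Set.range (jointImage.{u, v, w} (A := A) i))).topologicalClosure

instance : Ring (freeProdAlg.{u, v, w} A) := inferInstance

instance : Algebra ℂ (freeProdAlg.{u, v, w} A) := inferInstance

instance : StarRing (freeProdAlg.{u, v, w} A) := inferInstance

variable {A} in
/-- The canonical embedding of `A i` into the free product. -/
def freeProdIncl (i : I) : A i →⋆ₙₐ[ℂ] freeProdAlg.{u, v, w} A where
  toFun a := ⟨jointImage i a, StarSubalgebra.le_topologicalClosure _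
    (StarAlgebra.subset_adjoin ℂ _ (Set.mem_iUnion.2 ⟨i, a, rfl⟩))⟩
  map_smul' c a := Subtype.ext (map_smul (jointImage i) c a)
  map_zero' := Subtype.ext (map_zero (jointImage i))
  map_add' a b := Subtype.ext (map_add (jointImage i) a b)
  map_mul' a b := Subtype.ext (map_mul (jointImage i) a b)
  map_star' a := Subtype.ext (map_star (jointImage i) a)

variable {A} in
/-- The representation of the free product given by a joint representation. -/
def freeProdEval (R : JointRep.{u, v, w} A) :
    freeProdAlg.{u, v, w} A →⋆ₐ[ℂ] R.target where
  toFun x := x.1 R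
  map_one' := rfl
  map_mul' _ _ := rfl
  map_zero' := rfl
  map_add' _ _ := rfl
  commutes' _ := rfl
  map_star' _ := rfl

end FreeProductAlgebra

section ProductState

variable {I : Type v} [LinearOrder I] {A : I → Type u} [∀ i, CStarAlgebra (A i)]
  {H : I → Type u} [∀ i, NormedAddCommGroup (H i)] [∀ i, InnerProductSpace ℂ (H i)]
  [∀ i, CompleteSpace (H i)]

theorem vacuum_ne_zero (ξ : ∀ i, H i) : vacuum ξ ≠ 0 := by
  intro h
  have h1 := wordVec_self ξ ⟨[], .nil⟩ (emptyVec ξ)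
  rw [← vacuum, h] at h1
  have h2 := (congrArg norm h1).trans (norm_emptyVec ξ)
  exact zero_ne_one (norm_zero.symm.trans h2)

/-- The joint representation `a ↦ λ̃ i (σ i a)` on the free product of Hilbert spaces. -/
def vJointRep (ξ : ∀ i, H i) (hξ : ∀ i, ‖ξ i‖ = 1) (σ : ∀ i, A i →⋆ₐ[ℂ] (H i →L[ℂ] H i)) :
    JointRep.{u, v, max u v} A where
  target := FreeProd ξ →L[ℂ] FreeProd ξ
  toNontrivial :=
    have : Nontrivial (FreeProd ξ) := ⟨vacuum ξ, 0, vacuum_ne_zero ξ⟩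
    inferInstance
  rep i := (vLeftRep ξ hξ i).comp (σ i).toNonUnitalStarAlgHom

/-- The V-monotone product of states, `a₁ ⋯ aₙ ↦ ⟨λ̃ i₁ (σ i₁ a₁) ⋯ λ̃ iₙ (σ iₙ aₙ) ξ, ξ⟩`. -/
def vProductState (ξ : ∀ i, H i) (hξ : ∀ i, ‖ξ i‖ = 1) (σ : ∀ i, A i →⋆ₐ[ℂ] (H i →L[ℂ] H i)) :
    freeProdAlg.{u, v, max u v} A →ₗ[ℂ] ℂ :=
  (vectorState (vacuum ξ)).comp (freeProdEval (vJointRep ξ hξ σ)).toAlgHom.toLinearMap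

end ProductState

end VMonotone

end

/-!
Let `λ̃ i` be the V-monotone left representations. A centered operator `T` on `H i` (that is,
`⟪ξ i, T (ξ i)⟫ = 0`) maps `ξ i` into `H° i`, so `λ̃ i (T)` sends the summand of the V-monotone
product at a word `l` with first letter different from `i` into the summand at `i :: l`, and to `0`
if `i :: l` is not a V-word (`vLeftRep_mem_vSummand`). Hence the adjoint of a product
`λ̃ i₁ (T₁) ⋯ λ̃ iₙ (Tₙ)` with centered factors sends the vacuum vector into the summand at
`iₙ, …, i₁` (`star_prod_mem_vSummand`). This yields both conditions of V-monotone independence.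

* Freeness: for `n ≥ 1` that summand is orthogonal to the vacuum vector.
* The unit condition: the inner unit at `i` is the projection `U i`. Moved to the left side of the
  scalar product, it acts on the summand at the reversed word as the identity if this word prolonged
  by `i` is a V-word, and as `0` otherwise. The operators that follow the inner unit play no role.
  V-words are stable under reversal and under passage to prefixes, so the condition can be read off
  from the longest prefix that is a V-word.

V-monotone independence of the ranges of a family of homomorphisms depends only on the mixed
moments (`isVMonotoneIndependent_range`), and these are the same for the operators on the free
product of Hilbert spaces, for their restrictions, and for the embeddings in the free product of
C⋆-algebras. The product functional is a state because it is a vector state composed with a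
`*`-homomorphism.
-/

namespace VMonotone

/-! ### Vector states and the free product of C⋆-algebras -/

theorem vectorState_apply_eq_inner_star {K : Type*} [NormedAddCommGroup K] [InnerProductSpace ℂ K]
    [CompleteSpace K] (Ω : K) (P Q : K →L[ℂ] K) :
    vectorState Ω (P * Q) = ⟪star P Ω, Q Ω⟫_ℂ := by
  rw [ContinuousLinearMap.star_eq_adjoint, ContinuousLinearMap.adjoint_inner_left]
  rfl

theorem isState_vectorState {K : Type*} [NormedAddCommGroup K] [InnerProductSpace ℂ K]
    [CompleteSpace K] {Ω : K} (hΩ : ⟪Ω, Ω⟫_ℂ = 1) : IsState (vectorState Ω) where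
  map_one := hΩ
  nonneg T := by
    rw [vectorState_apply_eq_inner_star, star_star, inner_self_eq_norm_sq_to_K]
    exact pow_nonneg (RCLike.ofReal_nonneg.2 (norm_nonneg _)) 2

theorem continuous_vectorState {K : Type*} [NormedAddCommGroup K] [InnerProductSpace ℂ K]
    (Ω : K) : Continuous (vectorState Ω) := by
  change Continuous fun T : K →L[ℂ] K => ⟪Ω, T Ω⟫_ℂ
  fun_prop

theorem continuous_freeProdEval {I : Type v} {A : I → Type u} [∀ i, CStarAlgebra (A i)]
    (R : JointRep.{u, v, w} A) : Continuous (freeProdEval R) :=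
  (lp.evalCLM ℂ (fun R : JointRep.{u, v, w} A => R.target) ∞ R).continuous.comp
    continuous_subtype_val

/-! ### Words -/

section Words

variable {I : Type v} [LinearOrder I]

theorem IsVWord.reverse {l : List I} (h : IsVWord l) : IsVWord l.reverse := by
  obtain ⟨p, m, q, rfl, hp, hq⟩ := h
  refine ⟨q.reverse, m, p.reverse, by simp, ?_, ?_⟩
  · have := List.isChain_reverse.2 (show (m :: q).IsChain (flip (· > ·)) from hq)
    rwa [List.reverse_cons] at this
  · have := List.isChain_reverse.2 (show (p ++ [m]).IsChain (flip (· < ·)) from hp)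
    rwa [List.reverse_append] at this

theorem IsVWord.of_append_right {l t : List I} (ht : t ≠ []) (h : IsVWord (l ++ t)) :
    IsVWord t := by
  induction l with
  | nil => exact h
  | cons i l ih => exact ih (h.of_cons (by simp [ht]))

theorem IsVWord.of_prefix {l t : List I} (hl : l ≠ []) (hlt : l <+: t) (h : IsVWord t) :
    IsVWord l := by
  obtain ⟨s, rfl⟩ := hlt
  have h' := h.reverse
  rw [List.reverse_append] at h'
  simpa using (h'.of_append_right (by simpa using hl)).reverse

/-- If `r` is the length of the longest prefix of `p ++ i :: q` that is a V-word, then `p ++ [i]` is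
a V-word exactly when it is not longer than `r`. -/
theorem isVWord_append_singleton_iff {p q : List I} {i : I} {r : ℕ}
    (hV : IsVWord ((p ++ i :: q).take r))
    (hmax : r < (p ++ i :: q).length → ¬ IsVWord ((p ++ i :: q).take (r + 1))) :
    IsVWord (p ++ [i]) ↔ p.length + 1 ≤ r := by
  have hpre : p ++ [i] = (p ++ i :: q).take (p.length + 1) := by simp [List.take_append]
  constructor
  · intro h
    by_contra! hlt
    have hlen : r < (p ++ i :: q).length := by simp; omega
    refine hmax hlen (h.of_prefix ?_ ?_)
    · simp
    · rw [hpre]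
      exact List.take_prefix_take_left (by omega)
  · intro h
    refine hV.of_prefix (by simp) ?_
    rw [hpre]
    exact List.take_prefix_take_left h

end Words

/-! ### Centered products applied to the vacuum vector -/

section Vacuum

variable {I : Type v} [LinearOrder I] {H : I → Type u} [∀ i, NormedAddCommGroup (H i)]
  [∀ i, InnerProductSpace ℂ (H i)]

/-- The summand of the V-monotone product at the word `l`; it is `0` if `l` is neither empty nor a
V-word. -/
abbrev vSummand (ξ : ∀ i, H i) (l : List I) : Submodule ℂ (FreeProd ξ) :=
  supported ξ {w | w = l ∧ (w = [] ∨ IsVWord w)}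

theorem vacuum_mem_vSummand (ξ : ∀ i, H i) : vacuum ξ ∈ vSummand ξ [] := by
  intro w hw
  refine wordVec_ne ξ _ _ ?_
  rintro rfl
  exact hw ⟨rfl, .inl rfl⟩

theorem inner_vacuum_self (ξ : ∀ i, H i) : ⟪vacuum ξ, vacuum ξ⟫_ℂ = 1 := by
  rw [vacuum, inner_wordVec, wordVec_self, inner_self_eq_norm_sq_to_K, norm_emptyVec]
  simp

theorem inner_vSummand_vacuum (ξ : ∀ i, H i) {l : List I} (hl : l ≠ []) {f : FreeProd ξ}
    (hf : f ∈ vSummand ξ l) : ⟪f, vacuum ξ⟫_ℂ = 0 := by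
  rw [← inner_conj_symm, vacuum, inner_wordVec, hf ⟨[], .nil⟩ fun h => hl h.1.symm,
    inner_zero_right, map_zero]

theorem mem_FreeProdNot_of_mem_vSummand (ξ : ∀ i, H i) {i : I} {l : List I}
    (hl : l.head? ≠ some i) {f : FreeProd ξ} (hf : f ∈ vSummand ξ l) : f ∈ FreeProdNot ξ i := by
  intro w hw
  refine hf w ?_
  rintro ⟨h, -⟩
  exact hw (h ▸ hl)

theorem vProj_of_isVWord_cons (ξ : ∀ i, H i) {i : I} {l : List I} (h : IsVWord (i :: l))
    {f : FreeProd ξ} (hf : f ∈ vSummand ξ l) : vProj ξ i f = f := by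
  refine Submodule.starProjection_eq_self_iff.2 fun w hw => hf w ?_
  rintro ⟨rfl, hnil | hV⟩
  · exact hw (.inl hnil)
  · exact hw (.inr ⟨hV, .inr h⟩)

theorem vProj_of_not_isVWord_cons (ξ : ∀ i, H i) {i : I} {l : List I} (hl : l.head? ≠ some i)
    (h : ¬ IsVWord (i :: l)) {f : FreeProd ξ} (hf : f ∈ vSummand ξ l) : vProj ξ i f = 0 := by
  classical
  ext1
  funext w
  rw [starProjection_supported, lp.coeFn_zero, Pi.zero_apply]
  split_ifs with hw
  · refine hf w ?_
    rintro ⟨rfl, -⟩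
    rcases hw with hw | ⟨-, hw | hw⟩
    · rw [hw] at h
      exact h (isVWord_singleton i)
    · exact hl hw
    · exact h hw
  · rfl

theorem leftRep_apply_of_mem_FreeProdNot (ξ : ∀ i, H i) (hξ : ∀ i, ‖ξ i‖ = 1) (i : I)
    (T : H i →L[ℂ] H i) (f : FreeProdNot ξ i) :
    leftRep ξ hξ i T f.1 = ⟪ξ i, T (ξ i)⟫_ℂ • f.1 +
      prepend ξ i ((Centered ξ i).orthogonalProjectionOnto (T (ξ i))) f.1 := by
  have h0 : prepend ξ i 0 f.1 = 0 := by
    simpa using prepend_smul_left ξ i 0 0 f.1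
  have hf : glue ξ hξ i (htmul (ξ i) f) = f.1 := by
    rw [glue_htmul, Submodule.orthogonalProjectionOnto_orthogonal_apply_eq_zero
      (Submodule.mem_span_singleton_self (ξ i)), h0, inner_self_eq_norm_sq_to_K, hξ i]
    simp
  conv_lhs => rw [← hf]
  rw [leftRep_glue, amplify_htmul, glue_htmul]

theorem prepend_mem_vSummand (ξ : ∀ i, H i) {i : I} {l : List I} (h : IsVWord (i :: l))
    (x : Centered ξ i) {f : FreeProd ξ} (hf : f ∈ vSummand ξ l) :
    prepend ξ i x f ∈ vSummand ξ (i :: l) := by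
  intro w hw
  rw [prepend_apply]
  by_cases hr : w ∈ Set.range (consWord i)
  · obtain ⟨w, rfl⟩ := hr
    rw [prependFun_consWord, hf w.1, consVec_zero]
    rintro ⟨hwl, -⟩
    have e : (consWord i w).1 = i :: l := congrArg (i :: ·) hwl
    exact hw ⟨e, .inr (e ▸ h)⟩
  · exact prependFun_eq_zero_of_notMem _ _ _ _ _ hr

variable [∀ i, CompleteSpace (H i)]

theorem vLeftRep_apply (ξ : ∀ i, H i) (hξ : ∀ i, ‖ξ i‖ = 1) (i : I) (T : H i →L[ℂ] H i)
    (f : FreeProd ξ) :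
    vLeftRep ξ hξ i T f = vProj ξ i (leftRep ξ hξ i T (vProj ξ i f)) :=
  rfl

theorem vLeftRep_apply_eq_leftRep (ξ : ∀ i, H i) (hξ : ∀ i, ‖ξ i‖ = 1) (i : I)
    (T : H i →L[ℂ] H i) (f : FreeProd ξ) :
    vLeftRep ξ hξ i T f = leftRep ξ hξ i T (vProj ξ i f) := by
  have h := DFunLike.congr_fun (vProj_leftRep ξ hξ i T) (vProj ξ i f)
  rw [mul_apply_eq_comp, mul_apply_eq_comp] at h
  rw [vLeftRep_apply, h]
  exact congrArg _ (DFunLike.congr_fun (vProj_mul_vProj ξ i) f)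

theorem vLeftRep_one (ξ : ∀ i, H i) (hξ : ∀ i, ‖ξ i‖ = 1) (i : I) :
    vLeftRep ξ hξ i 1 = vProj ξ i := by
  have h : leftRep ξ hξ i 1 = 1 := leftRep_ext ξ hξ i fun x f => by
    rw [leftRep_glue, amplify_htmul]; rfl
  ext1 f
  rw [vLeftRep_apply_eq_leftRep, h, one_apply_eq_self]

theorem vectorState_vLeftRep (ξ : ∀ i, H i) (hξ : ∀ i, ‖ξ i‖ = 1) (i : I) (T : H i →L[ℂ] H i) :
    vectorState (vacuum ξ) (vLeftRep ξ hξ i T) = ⟪ξ i, T (ξ i)⟫_ℂ := by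
  have hmem : vacuum ξ ∈ FreeProdNot ξ i :=
    mem_FreeProdNot_of_mem_vSummand ξ (by simp) (vacuum_mem_vSummand ξ)
  change ⟪vacuum ξ, vLeftRep ξ hξ i T (vacuum ξ)⟫_ℂ = _
  rw [vLeftRep_apply_eq_leftRep,
    vProj_of_isVWord_cons ξ (isVWord_singleton i) (vacuum_mem_vSummand ξ),
    leftRep_apply_of_mem_FreeProdNot ξ hξ i T ⟨_, hmem⟩, inner_add_right, inner_smul_right,
    inner_vacuum_self, inner_prepend_right ξ i _ ⟨_, hmem⟩, mul_one, add_zero]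

/-- A centered operator of the `i`-th algebra moves the summand at `l` to the summand at `i :: l`,
and kills it if `i :: l` is not a V-word. -/
theorem vLeftRep_mem_vSummand (ξ : ∀ i, H i) (hξ : ∀ i, ‖ξ i‖ = 1) {i : I} {T : H i →L[ℂ] H i}
    (hT : ⟪ξ i, T (ξ i)⟫_ℂ = 0) {l : List I} (hl : l.head? ≠ some i) {f : FreeProd ξ}
    (hf : f ∈ vSummand ξ l) : vLeftRep ξ hξ i T f ∈ vSummand ξ (i :: l) := by
  rw [vLeftRep_apply_eq_leftRep]
  by_cases h : IsVWord (i :: l)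
  · rw [vProj_of_isVWord_cons ξ h hf, leftRep_apply_of_mem_FreeProdNot ξ hξ i T
      ⟨f, mem_FreeProdNot_of_mem_vSummand ξ hl hf⟩, hT, zero_smul, zero_add]
    exact prepend_mem_vSummand ξ h _ hf
  · rw [vProj_of_not_isVWord_cons ξ hl h hf, map_zero]
    exact Submodule.zero_mem _

/-- The adjoint of `λ̃ i₁ (T₁) ⋯ λ̃ iₙ (Tₙ)` with centered `T₁, …, Tₙ` moves the summand at `l` to
the summand at `iₙ, …, i₁` followed by `l`. -/
theorem star_prod_mem_vSummand (ξ : ∀ i, H i) (hξ : ∀ i, ‖ξ i‖ = 1)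
    (p : List (Σ i, H i →L[ℂ] H i)) (hp : ∀ x ∈ p, ⟪ξ x.1, x.2 (ξ x.1)⟫_ℂ = 0) {l : List I}
    (hl : ((p.map Sigma.fst).reverse ++ l).IsChain (· ≠ ·)) {f : FreeProd ξ}
    (hf : f ∈ vSummand ξ l) :
    star (p.map fun x => vLeftRep ξ hξ x.1 x.2).prod f ∈
      vSummand ξ ((p.map Sigma.fst).reverse ++ l) := by
  induction p generalizing l f with
  | nil => simpa using hf
  | cons x p ih =>
    have hx : ⟪ξ x.1, star x.2 (ξ x.1)⟫_ℂ = 0 := by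
      rw [ContinuousLinearMap.star_eq_adjoint, ContinuousLinearMap.adjoint_inner_right,
        ← inner_conj_symm, hp x (by simp), map_zero]
    rw [List.map_cons, List.reverse_cons, List.append_assoc, List.singleton_append] at hl ⊢
    have hl' : l.head? ≠ some x.1 := by
      have h := hl.right_of_append
      cases l with
      | nil => simp
      | cons j l => simpa using (List.isChain_cons_cons.1 h).1.symm
    rw [List.map_cons, List.prod_cons, star_mul, mul_apply_eq_comp, ← map_star]
    exact ih (fun y hy => hp y (by simp [hy])) hl (vLeftRep_mem_vSummand ξ hξ hx hl' hf)

/-- The freeness condition for the vacuum state. -/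
theorem vectorState_prod_eq_zero (ξ : ∀ i, H i) (hξ : ∀ i, ‖ξ i‖ = 1)
    (p : List (Σ i, H i →L[ℂ] H i)) (hne : p ≠ [])
    (hp : ∀ x ∈ p, ⟪ξ x.1, x.2 (ξ x.1)⟫_ℂ = 0) (hc : (p.map Sigma.fst).IsChain (· ≠ ·)) :
    vectorState (vacuum ξ) (p.map fun x => vLeftRep ξ hξ x.1 x.2).prod = 0 := by
  have hc' : ((p.map Sigma.fst).reverse ++ []).IsChain (· ≠ ·) := by
    rw [List.append_nil, List.isChain_reverse]
    exact hc.imp fun _ _ h => h.symm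
  have h := star_prod_mem_vSummand ξ hξ p hp hc' (vacuum_mem_vSummand ξ)
  rw [← mul_one (List.prod _), vectorState_apply_eq_inner_star]
  exact inner_vSummand_vacuum ξ (by simpa using hne) h

open scoped Classical in
/-- The unit condition for the vacuum state: behind centered factors the inner unit `U i` acts on
the summand at the reversed word, as the identity or as `0`. -/
theorem vectorState_prod_mul_vProj_mul (ξ : ∀ i, H i) (hξ : ∀ i, ‖ξ i‖ = 1)
    (p : List (Σ i, H i →L[ℂ] H i)) (hp : ∀ x ∈ p, ⟪ξ x.1, x.2 (ξ x.1)⟫_ℂ = 0) {i : I}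
    (hc : (p.map Sigma.fst ++ [i]).IsChain (· ≠ ·)) (Q : FreeProd ξ →L[ℂ] FreeProd ξ) :
    vectorState (vacuum ξ) ((p.map fun x => vLeftRep ξ hξ x.1 x.2).prod * vProj ξ i * Q) =
      if IsVWord (p.map Sigma.fst ++ [i]) then
        vectorState (vacuum ξ) ((p.map fun x => vLeftRep ξ hξ x.1 x.2).prod * Q) else 0 := by
  have hrev : (i :: (p.map Sigma.fst).reverse).IsChain (· ≠ ·) := by
    have := List.isChain_reverse.2 (hc.imp fun _ _ h => h.symm :
      (p.map Sigma.fst ++ [i]).IsChain (flip (· ≠ ·)))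
    rwa [List.reverse_append] at this
  have hhead : (p.map Sigma.fst).reverse.head? ≠ some i := by
    generalize (p.map Sigma.fst).reverse = l at hrev
    cases l with
    | nil => simp
    | cons j l => simpa using (List.isChain_cons_cons.1 hrev).1.symm
  have h := star_prod_mem_vSummand ξ hξ p hp (l := [])
    (by rw [List.append_nil]; exact hrev.tail) (vacuum_mem_vSummand ξ)
  rw [List.append_nil] at h
  have hU : star (vProj ξ i) = vProj ξ i := isSelfAdjoint_starProjection (VProdAt ξ i)
  rw [vectorState_apply_eq_inner_star, vectorState_apply_eq_inner_star, star_mul, hU,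
    mul_apply_eq_comp]
  split_ifs with hV
  · rw [vProj_of_isVWord_cons ξ (by simpa using hV.reverse) h]
  · rw [vProj_of_not_isVWord_cons ξ hhead (fun h' => hV (by simpa using h'.reverse)) h,
      inner_zero_left]

end Vacuum

/-! ### Independence from moments -/

/-- A word in the ranges of the maps `τ i` comes from a word in the algebras `A i`. -/
theorem exists_lift_of_mem_range {I : Type*} {A : I → Type*} {B : Type*} (τ : ∀ i, A i → B)
    (l : List (I × B))
    (h : ∀ x ∈ l, x.2 ∈ Set.range (τ x.1)) :
    ∃ l' : List (Σ i, A i), l = l'.map fun x => (x.1, τ x.1 x.2) := by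
  induction l with
  | nil => exact ⟨[], rfl⟩
  | cons x l ih =>
    obtain ⟨l', rfl⟩ := ih fun y hy => h y (by simp [hy])
    obtain ⟨a, ha⟩ := h x (by simp)
    exact ⟨⟨x.1, a⟩ :: l', by simp [ha]⟩

section Moments

variable {I : Type v} [LinearOrder I] {A : I → Type u} [∀ i, CStarAlgebra (A i)]
  {H : I → Type u} [∀ i, NormedAddCommGroup (H i)] [∀ i, InnerProductSpace ℂ (H i)]
  [∀ i, CompleteSpace (H i)]

/-- Homomorphisms `τ i` whose mixed moments are those of `λ̃ i ∘ σ i` in the vacuum state have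
V-monotonically independent ranges, with inner units `τ i 1`. -/
theorem isVMonotoneIndependent_range (ξ : ∀ i, H i) (hξ : ∀ i, ‖ξ i‖ = 1)
    (σ : ∀ i, A i →⋆ₐ[ℂ] (H i →L[ℂ] H i)) {B : Type*} [Ring B] [Algebra ℂ B] [StarRing B]
    (ψ : B →ₗ[ℂ] ℂ) (τ : ∀ i, A i →⋆ₙₐ[ℂ] B)
    (hψ : ∀ l : List (Σ i, A i), ψ (l.map fun x => τ x.1 x.2).prod =
      vectorState (vacuum ξ) (l.map fun x => vLeftRep ξ hξ x.1 (σ x.1 x.2)).prod) :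
    IsVMonotoneIndependent ψ
      (fun i => (NonUnitalStarAlgHom.range (τ i)).toNonUnitalSubalgebra) := by
  have hψ1 : ∀ i (a : A i), ψ (τ i a) = ⟪ξ i, σ i a (ξ i)⟫_ℂ := fun i a => by
    have h := hψ [⟨i, a⟩]
    simp only [List.map_cons, List.map_nil, List.prod_singleton] at h
    rw [h, vectorState_vLeftRep]
  -- words of elements of the `A i`, read as words of operators on the `H i`
  let s : List (Σ i, A i) → List (Σ i, H i →L[ℂ] H i) := List.map fun x => ⟨x.1, σ x.1 x.2⟩
  have hfst : ∀ l, (s l).map Sigma.fst = l.map Sigma.fst := fun l => by simp [s]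
  have hrep : ∀ l, (s l).map (fun x => vLeftRep ξ hξ x.1 x.2) =
      l.map fun x => vLeftRep ξ hξ x.1 (σ x.1 x.2) := fun l => by simp [s]
  have hcent : ∀ l : List (Σ i, A i), (∀ x ∈ l, ψ (τ x.1 x.2) = 0) →
      ∀ x ∈ s l, ⟪ξ x.1, x.2 (ξ x.1)⟫_ℂ = 0 := by
    intro l h x hx
    obtain ⟨y, hy, rfl⟩ := List.mem_map.1 hx
    exact (hψ1 _ _).symm.trans (h y hy)
  refine ⟨fun i => τ i 1, fun i => ⟨⟨1, rfl⟩, ?_⟩, fun i => ?_, ?_, ?_⟩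
  · rintro _ ⟨a, rfl⟩
    change τ i 1 * τ i a = τ i a ∧ τ i a * τ i 1 = τ i a
    rw [← map_mul, ← map_mul, one_mul, mul_one]
    exact ⟨rfl, rfl⟩
  · rw [hψ1, map_one, one_apply_eq_self, inner_self_eq_norm_sq_to_K, hξ i]
    simp
  · intro l hne hc hB h0
    obtain ⟨l, rfl⟩ := exists_lift_of_mem_range (fun i => τ i) l hB
    simp only [List.map_map, Function.comp_def] at hc ⊢
    rw [hψ, ← hrep]
    refine vectorState_prod_eq_zero ξ hξ (s l) (by simpa [s] using hne) (hcent l fun x hx => ?_)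
      (by rw [hfst]; exact hc)
    exact h0 _ (List.mem_map_of_mem hx)
  · intro p q x r hc hB h0 _ _ hV hmax
    obtain ⟨p, rfl⟩ := exists_lift_of_mem_range (fun i => τ i) p fun y hy => hB y (by simp [hy])
    obtain ⟨q, rfl⟩ := exists_lift_of_mem_range (fun i => τ i) q fun y hy => hB y (by simp [hy])
    obtain ⟨i, b⟩ := x
    simp only [List.map_append, List.map_cons, List.map_map, Function.comp_def] at hc hV hmax ⊢
    have hiff := isVWord_append_singleton_iff (p := p.map Sigma.fst) (q := q.map Sigma.fst)
      (i := i) (r := r) hV (fun h => hmax (by simpa using h))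
    have h1 := hψ (p ++ ⟨i, 1⟩ :: q)
    have h2 := hψ (p ++ q)
    simp only [List.map_append, List.map_cons, List.prod_append, List.prod_cons, map_one,
      vLeftRep_one] at h1 h2
    have hc' : ((s p).map Sigma.fst ++ [i]).IsChain (· ≠ ·) := by
      rw [hfst]
      exact hc.prefix ⟨q.map Sigma.fst, by simp⟩
    have h3 := vectorState_prod_mul_vProj_mul ξ hξ (s p)
      (hcent p fun y hy => h0 _ (List.mem_map_of_mem hy)) hc'
      (q.map fun x => vLeftRep ξ hξ x.1 (σ x.1 x.2)).prod
    rw [hfst, hrep] at h3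
    rw [mul_assoc, h1, h2, ← mul_assoc, h3]
    rw [List.length_map] at hiff ⊢
    simp only [hiff]

theorem vLeftRepOn_prod_apply (ξ : ∀ i, H i) (hξ : ∀ i, ‖ξ i‖ = 1)
    (l : List (Σ i, H i →L[ℂ] H i)) (f : VProd ξ) :
    ((l.map fun x => vLeftRepOn ξ hξ x.1 x.2).prod f : FreeProd ξ) =
      (l.map fun x => vLeftRep ξ hξ x.1 x.2).prod f.1 := by
  induction l with
  | nil => rfl
  | cons x l ih =>
    rw [List.map_cons, List.map_cons, List.prod_cons, List.prod_cons, mul_apply_eq_comp,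
      mul_apply_eq_comp, ← ih]
    rfl

theorem vProductState_apply (ξ : ∀ i, H i) (hξ : ∀ i, ‖ξ i‖ = 1)
    (σ : ∀ i, A i →⋆ₐ[ℂ] (H i →L[ℂ] H i)) (x : freeProdAlg.{u, v, max u v} A) :
    vProductState ξ hξ σ x = vectorState (vacuum ξ) (freeProdEval (vJointRep ξ hξ σ) x) :=
  rfl

theorem vProductState_prod (ξ : ∀ i, H i) (hξ : ∀ i, ‖ξ i‖ = 1)
    (σ : ∀ i, A i →⋆ₐ[ℂ] (H i →L[ℂ] H i)) (l : List (Σ i, A i)) :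
    vProductState ξ hξ σ (l.map fun x => freeProdIncl x.1 x.2).prod =
      vectorState (vacuum ξ) (l.map fun x => vLeftRep ξ hξ x.1 (σ x.1 x.2)).prod := by
  rw [vProductState_apply, map_list_prod, List.map_map]
  rfl

theorem isState_vProductState (ξ : ∀ i, H i) (hξ : ∀ i, ‖ξ i‖ = 1)
    (σ : ∀ i, A i →⋆ₐ[ℂ] (H i →L[ℂ] H i)) : IsState (vProductState ξ hξ σ) where
  map_one := by
    rw [vProductState_apply, map_one]
    exact inner_vacuum_self ξ
  nonneg a := by
    rw [vProductState_apply, map_mul, map_star]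
    exact (isState_vectorState (inner_vacuum_self ξ)).nonneg _

end Moments

end VMonotone

theorem mainTheorem3 {I : Type v} [LinearOrder I]
    -- a family of C⋆-probability spaces
    {A : I → Type u} [∀ i, CStarAlgebra (A i)]
    (φ : ∀ i, A i →ₗ[ℂ] ℂ) (hφ : ∀ i, VMonotone.IsState (φ i))
    -- Hilbert spaces, unit vectors and unital representations that give the states
    {H : I → Type u} [∀ i, NormedAddCommGroup (H i)] [∀ i, InnerProductSpace ℂ (H i)]
    [∀ i, CompleteSpace (H i)]
    (ξ : ∀ i, H i) (hξ : ∀ i, ‖ξ i‖ = 1)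
    (σ : ∀ i, A i →⋆ₐ[ℂ] (H i →L[ℂ] H i))
    (hσ : ∀ i a, φ i a = ⟪ξ i, σ i a (ξ i)⟫_ℂ) :
    -- independence of the image algebras with respect to the vacuum state, as operators on the
    -- free product of Hilbert spaces
    VMonotone.IsVMonotoneIndependent (VMonotone.vectorState (VMonotone.vacuum ξ))
      (fun i => (NonUnitalStarAlgHom.range ((VMonotone.vLeftRep ξ hξ i).comp
        (σ i).toNonUnitalStarAlgHom)).toNonUnitalSubalgebra) ∧
    -- the same, as operators on the V-monotone product of Hilbert spaces
    VMonotone.IsVMonotoneIndependent (VMonotone.vectorState (VMonotone.vVacuum ξ))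
      (fun i => (NonUnitalStarAlgHom.range ((VMonotone.vLeftRepOn ξ hξ i).comp
        (σ i).toNonUnitalStarAlgHom)).toNonUnitalSubalgebra) ∧
    -- the vacuum state extends the given states
    (∀ i a, VMonotone.vectorState (VMonotone.vacuum ξ) (VMonotone.vLeftRep ξ hξ i (σ i a)) =
      φ i a) ∧
    -- the V-monotone product of states on the free product of the C⋆-algebras
    VMonotone.IsState (VMonotone.vProductState ξ hξ σ) ∧
    Continuous (VMonotone.vProductState ξ hξ σ) ∧
    (∀ l : List (Σ i, A i),
      VMonotone.vProductState ξ hξ σ (l.map fun x => VMonotone.freeProdIncl x.1 x.2).prod =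
        VMonotone.vectorState (VMonotone.vacuum ξ)
          (l.map fun x => VMonotone.vLeftRep ξ hξ x.1 (σ x.1 x.2)).prod) ∧
    (∀ i a, VMonotone.vProductState ξ hξ σ (VMonotone.freeProdIncl i a) = φ i a) ∧
    VMonotone.IsVMonotoneIndependent (VMonotone.vProductState ξ hξ σ)
      (fun i => (NonUnitalStarAlgHom.range
        (VMonotone.freeProdIncl (A := A) i)).toNonUnitalSubalgebra) := by
  have hvac : ∀ i a, VMonotone.vectorState (VMonotone.vacuum ξ)
      (VMonotone.vLeftRep ξ hξ i (σ i a)) = φ i a := fun i a =>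
    (VMonotone.vectorState_vLeftRep ξ hξ i (σ i a)).trans (hσ i a).symm
  refine ⟨VMonotone.isVMonotoneIndependent_range ξ hξ σ _ _ fun l => rfl,
    VMonotone.isVMonotoneIndependent_range ξ hξ σ _ _ fun l => ?_, hvac,
    VMonotone.isState_vProductState ξ hξ σ,
    (VMonotone.continuous_vectorState _).comp (VMonotone.continuous_freeProdEval _),
    VMonotone.vProductState_prod ξ hξ σ, hvac,
    VMonotone.isVMonotoneIndependent_range ξ hξ σ _ _ (VMonotone.vProductState_prod ξ hξ σ)⟩
  have h := VMonotone.vLeftRepOn_prod_apply ξ hξ (l.map fun x => ⟨x.1, σ x.1 x.2⟩)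
    (VMonotone.vVacuum ξ)
  rw [List.map_map, List.map_map] at h
  exact congrArg (fun f => ⟪VMonotone.vacuum ξ, f⟫_ℂ) h
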